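/- Fix a universe, whose members are called small sets; every category is assumed to have small Hom-sets unless otherwise stated. Let $\mathbf K$ be a commutative ring and let $\mathbf A$ be a small $\mathbf K$-linear category (small Hom-sets, and a small set of isomorphism classes of objects). Let $\mathrm{Mod}(\mathbf A)$ be the abelian category of $\mathbf K$-linear functors $\mathbf A^{\mathrm{op}}\to \mathrm{Mod}(\mathbf K)$, let $\mathrm D(\mathbf A)=\mathrm D(\mathrm{Mod}(\mathbf A))$ be its unbounded derived category (equivalently, the derived category of dg modules over $\mathbf A$, viewed as a dg category concentrated in degree $0$), and let $\mathsf Y\colon\mathbf A\to\mathrm D(\mathbf A)$ send $A$ to the representable module $\mathbf A(-,A)$ placed in degree $0$. Let $\mathbf L\subseteq\mathrm D(\mathbf A)$ be a localizing subcategory (a full triangulated subcategory closed under small coproducts), and let $\mathsf Q\colon\mathrm D(\mathbf A)\to\mathrm D(\mathbf A)/\mathbf L$ be the Verdier quotient functor. An object $C$ of a triangulated category $\mathbf T$ is compact if $\mathbf T(C,-)$ commutes with small coproducts. For a small set $\mathbf S$ of objects of a triangulated category $\mathbf T$ with small coproducts consider the conditions: (G1) an object $X$ is zero if and only if $\mathbf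 T(S,X[j])=0$ for all $S\in\mathbf S$ and $j\in\mathbb Z$; (G2) for every small family of maps $X_i\to Y_i$ such that $\mathbf T(S,X_i)\to\mathbf T(S,Y_i)$ is surjective for all $i$ and all $S\in\mathbf S$, the map $\mathbf T(S,\coprod_i X_i)\to\mathbf T(S,\coprod_i Y_i)$ is surjective for all $S\in\mathbf S$; (G3) there is a regular cardinal $\alpha$ such that, for every $S\in\mathbf S$, every map from $S$ to a small coproduct $\coprod_{i\in I}X_i$ factors through $\coprod_{i\in J}X_i$ for some $J\subseteq I$ with $|J|<\alpha$. A triangulated category with small Hom-sets and small coproducts is well generated if it has a small set of objects satisfying (G1), (G2) and (G3), and it is compactly generated by a small set $\mathbf S$ of compact objects if $\mathbf S$ satisfies (G1). (Small sets of objects are understood up to isomorphism.) Assume that $\mathrm D(\mathbf A)/\mathbf L$ has small Hom-sets and that (a.2) $\mathsf Q$ sends compact objects of $\mathrm D(\mathbf A)$ to compact objects of $\mathrm D(\mathbf A)/\mathbf L$. Then: 1. $\mathrm D(\mathbf A)/\mathbf L$ has small coproducts and is compactly generated by the objects $\mathsf Q(\mathsf Y(A))$, $A\in\mathbf A$. 2.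 Consequently, (a.1) $\mathrm D(\mathbf A)/\mathbf L$ is a well generated triangulated category. 3. If moreover (b.2) $(\mathrm D(\mathbf A)/\mathbf L)\bigl(\mathsf Q(\mathsf Y(A)),\mathsf Q(\mathsf Y(A'))[k]\bigr)=0$ for all $A,A'\in\mathbf A$ and all integers $k<0$, then also (b.1) $(\mathrm D(\mathbf A)/\mathbf L)\bigl(\mathsf Q(\mathsf Y(A)),\coprod_{i\in I}\mathsf Q(\mathsf Y(A_i))[k_i]\bigr)=0$ for all $A,A_i\in\mathbf A$ (with $I$ a small set) and all integers $k_i<0$. Thus, whenever $\mathrm D(\mathbf A)/\mathbf L$ has small Hom-sets, the hypotheses (a.2), (b.2) of the Lunts--Orlov criterion for $\mathrm D(\mathbf A)/\mathbf L$ to have a unique dg enhancement imply the hypotheses (a.1), (b.1) of the Canonaco--Stellari criterion for the same conclusion; that is, the Canonaco--Stellari criterion implies the Lunts--Orlov criterion. -/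

import Mathlib

open CategoryTheory CategoryTheory.Limits Opposite

universe u w v

namespace VerdierCompact

section Modules

variable (K : Type u) [CommRing K] (A : Type v) [Category.{u} A] [Preadditive A] [Linear K A]

/-- The functors `Aᵒᵖ ⥤ ModuleCat K` that are `K`-linear (additive and compatible with scalars). -/
def isLinear : ObjectProperty (Aᵒᵖ ⥤ ModuleCat.{u} K) :=
  fun F => F.Additive ∧ ∀ {X Y : A} (r : K) (f : X ⟶ Y), F.map (r • f).op = r • F.map f.op

instance : (isLinear K A).IsClosedUnderIsomorphisms where
  of_iso {F G} e hF := by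
    obtain ⟨h₁, h₂⟩ := hF
    have key : ∀ {X Y : Aᵒᵖ} (f : X ⟶ Y), G.map f = e.inv.app X ≫ F.map f ≫ e.hom.app Y := by
      intro X Y f; simp
    refine ⟨⟨fun {X Y f g} => ?_⟩, fun {X Y} r f => ?_⟩
    · simp only [key, F.map_add, Preadditive.add_comp, Preadditive.comp_add]
    · rw [key, key, h₂]; simp

/-- A subobject (in the weak sense of a family of jointly monic maps to linear functors)
is linear. -/
lemma isLinear_of_mono {ι : Type*} (F : Aᵒᵖ ⥤ ModuleCat.{u} K)
    (G : ι → Aᵒᵖ ⥤ ModuleCat.{u} K) (p : ∀ i, F ⟶ G i) (hG : ∀ i, isLinear K A (G i))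
    (hp : ∀ (Y : Aᵒᵖ) {T : ModuleCat.{u} K} (a b : T ⟶ F.obj Y),
      (∀ i, a ≫ (p i).app Y = b ≫ (p i).app Y) → a = b) : isLinear K A F := by
  refine ⟨⟨fun {X Y f g} => hp _ _ _ fun i => ?_⟩, fun {X Y} r f => hp _ _ _ fun i => ?_⟩
  · have := (hG i).1
    simp [Functor.map_add]
  · rw [(p i).naturality, (hG i).2, Linear.smul_comp, (p i).naturality, Linear.comp_smul]

/-- A quotient of a linear functor is linear. -/
lemma isLinear_of_epi {F G : Aᵒᵖ ⥤ ModuleCat.{u} K} (p : G ⟶ F) (hG : isLinear K A G)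
    [Epi p] : isLinear K A F := by
  refine ⟨⟨fun {X Y f g} => ?_⟩, fun {X Y} r f => ?_⟩
  · have := hG.1
    rw [← cancel_epi (p.app X), ← p.naturality, Functor.map_add]
    simp
  · rw [← cancel_epi (p.app _), ← p.naturality, hG.2]
    simp

instance : (isLinear K A).ContainsZero where
  exists_zero := by
    obtain ⟨Z, hZ⟩ := HasZeroObject.zero (C := Aᵒᵖ ⥤ ModuleCat.{u} K)
    exact ⟨Z, hZ, isLinear_of_mono K A (ι := PEmpty.{1}) Z (fun i => i.elim) (fun i => i.elim)
      (fun i => i.elim) (fun Y T a b _ => (hZ.obj Y).eq_of_tgt a b)⟩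

instance : (isLinear K A).IsClosedUnderKernels where
  kernels_le := by
    rintro _ ⟨f, k, hk, hf⟩
    have : Mono k.ι := mono_of_isLimit_fork hk
    exact isLinear_of_mono K A (ι := Unit) _ _ (fun _ => k.ι) (fun _ => hf.1)
      (fun Y T a b h => (cancel_mono (k.ι.app Y)).1 (h ()))

instance : (isLinear K A).IsClosedUnderCokernels where
  cokernels_le := by
    rintro _ ⟨f, k, hk, hf⟩
    have : Epi k.π := epi_of_isColimit_cofork hk
    exact isLinear_of_epi K A k.π hf.2

instance : (isLinear K A).IsClosedUnderFiniteProducts where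
  isClosedUnderLimitsOfShape J _ := ⟨by
    rintro F ⟨c⟩
    exact isLinear_of_mono K A F _ (fun j => c.π.app j) c.prop_diag_obj (fun Y T a b h =>
      (isLimitOfPreserves ((evaluation Aᵒᵖ (ModuleCat.{u} K)).obj Y) c.isLimit).hom_ext h)⟩

/-- The abelian category of right `A`-modules: `K`-linear functors `Aᵒᵖ ⥤ ModuleCat K`. -/
abbrev RightMod := (isLinear K A).FullSubcategory

/-- The Yoneda embedding `a ↦ A(-, a)` of `A` into right `A`-modules. -/
def yon : A ⥤ RightMod K A :=
  (isLinear K A).lift (linearYoneda K A) (fun a => ⟨inferInstance, fun r f => by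
    ext x
    exact Linear.smul_comp _ _ _ r f x⟩)
end Modules

section Generation

variable {T : Type v} [Category.{w} T] [Preadditive T] [HasShift T ℤ]

/-- An object `C` is compact if `T(C, -)` commutes with small coproducts. -/
def IsCompactObject (C : T) : Prop :=
  ∀ I : Type u, PreservesColimitsOfShape (Discrete I) (preadditiveCoyoneda.obj (op C))

/-- (G1): an object is zero if and only if it receives no nonzero map from any shift of an object
in `S`. -/
def SatisfiesG1 (S : ObjectProperty T) : Prop :=
  ∀ X : T, IsZero X ↔ ∀ (C : T), S C → ∀ (j : ℤ) (f : C ⟶ X⟦j⟧), f = 0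

/-- (G2): for every small family of maps `φ i : X i ⟶ Y i` which are all surjective on `T(C, -)`
for every `C` in `S`, the coproduct of the `φ i` is also surjective on `T(C, -)` for every `C`
in `S`. -/
def SatisfiesG2 [HasCoproducts.{u} T] (S : ObjectProperty T) : Prop :=
  ∀ (I : Type u) (X Y : I → T) (φ : ∀ i, X i ⟶ Y i),
    (∀ (i : I) (C : T), S C → Function.Surjective (fun f : C ⟶ X i => f ≫ φ i)) →
      ∀ C : T, S C → Function.Surjective (fun f : C ⟶ ∐ X => f ≫ Limits.Sigma.map φ)

/-- `C` is `α`-small: every map from `C` to a small coproduct factors through a subcoproduct with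
strictly less than `α` summands. -/
def IsCardinalSmall [HasCoproducts.{u} T] (α : Cardinal.{u}) (C : T) : Prop :=
  ∀ (I : Type u) (X : I → T) (f : C ⟶ ∐ X), ∃ J : Set I, Cardinal.mk J < α ∧
    ∃ g : C ⟶ ∐ (fun j : J => X j), g ≫ Sigma.desc (fun j : J => Sigma.ι X j) = f

/-- (G3): the objects of `S` are all `α`-small for a common regular cardinal `α`. -/
def SatisfiesG3 [HasCoproducts.{u} T] (S : ObjectProperty T) : Prop :=
  ∃ α : Cardinal.{u}, α.IsRegular ∧ ∀ C : T, S C → IsCardinalSmall α C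

variable (T) in
/-- `T` has small `Hom`-sets and small coproducts, and there is a small set of objects satisfying
(G1), (G2) and (G3). -/
structure IsWellGenerated : Prop where
  locallySmall : LocallySmall.{u} T
  hasCoproducts : HasCoproducts.{u} T
  exists_generators : ∃ S : ObjectProperty T, ObjectProperty.EssentiallySmall.{u} S ∧
    SatisfiesG1 S ∧ SatisfiesG2.{u} S ∧ SatisfiesG3.{u} S

/-- `T` has small `Hom`-sets and small coproducts, and `S` is a small set (up to isomorphism) of
compact objects of `T` satisfying (G1). -/
structure IsCompactlyGeneratedBy (S : ObjectProperty T) : Prop where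
  locallySmall : LocallySmall.{u} T
  hasCoproducts : HasCoproducts.{u} T
  essentiallySmall : ObjectProperty.EssentiallySmall.{u} S
  isCompactObject : ∀ C : T, S C → IsCompactObject.{u} C
  satisfiesG1 : SatisfiesG1 S

end Generation

section Quotient

variable (K : Type u) [CommRing K] (A : Type v) [Category.{u} A] [Preadditive A] [Linear K A]
  [HasDerivedCategory.{w} (RightMod K A)]

/-- The derived category `D(A)`. A dg module over `A`, seen as a dg category concentrated in
degree zero, is a complex of right `A`-modules, so `D(A)` is the homotopy category of such
complexes modulo the acyclic ones, i.e. the derived category of right `A`-modules. -/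
abbrev D := DerivedCategory (RightMod K A)

/-- The functor `A ⥤ D(A)` sending `a` to `A(-, a)` placed in degree zero. -/
noncomputable def yonD : A ⥤ D K A :=
  yon K A ⋙ DerivedCategory.singleFunctor (RightMod K A) 0

variable {K A} (L : ObjectProperty (D K A)) [L.IsTriangulated]

/-- The Verdier quotient `D(A)/L`: the localization of `D(A)` at the morphisms whose cone is
in `L`. -/
abbrev VerdierQuot := L.trW.Localization

/-- The quotient functor `D(A) ⥤ D(A)/L`. -/
noncomputable abbrev quotFunctor : D K A ⥤ VerdierQuot L := L.trW.Q

/-- The image in `D(A)/L` of the representable module `A(-, a)`. -/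
noncomputable abbrev quotYon (a : A) : VerdierQuot L := (quotFunctor L).obj ((yonD K A).obj a)

/-- (a.2): the quotient functor sends compact objects to compact objects. -/
def ConditionA2 : Prop :=
  ∀ X : D K A, IsCompactObject.{u} X → IsCompactObject.{u} ((quotFunctor L).obj X)

/-- (b.1): there are no nonzero maps in `D(A)/L` from the image of a representable to a small
coproduct of strictly negative shifts of images of representables. -/
def ConditionB1 : Prop :=
  ∀ (a : A) (I : Type u) (b : I → A) (k : I → ℤ), (∀ i, k i < 0) →
    ∀ c : Cofan (fun i => (quotYon L (b i))⟦k i⟧), IsColimit c →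
      ∀ f : quotYon L a ⟶ c.pt, f = 0

/-- (b.2): there are no nonzero maps in `D(A)/L` from the image of a representable to a strictly
negative shift of the image of a representable. -/
def ConditionB2 : Prop :=
  ∀ (a b : A) (k : ℤ), k < 0 → ∀ f : quotYon L a ⟶ (quotYon L b)⟦k⟧, f = 0

end Quotient

end VerdierCompact

/-! Compactness of `C` is used in an elementwise form, `FactorsFinitely`: a map from `C` to a
coproduct is a finite sum of maps through summands. For compact generators this gives (G2) and (G3)
with `α = ℵ₀`, and it reduces (b.1) to (b.2) summand by summand.

Representable modules are projective, compact and separating, so acyclicity of a complex is tested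
by maps from their shifts in the homotopy category. Hence acyclic complexes are closed under
coproducts, `D(A)` has coproducts computed on complexes, and representables stay compact there;
(a.2) carries this to the quotient. As `L` is localizing, the quotient functor `Q` also creates
coproducts in `D(A)/L` (`preservesCoproducts_of_isLocalization`).

The real content is (G1), through `eq_zero_of_generates`. Suppose `X` receives no nonzero map from
the images of shifted representables. Given `Q M ⟶ X`, take the cone of the coproduct of all maps
from shifted representables to `M`: these maps die in the cone, while `Q M ⟶ X` extends to it.
Iterating gives a sequence whose homotopy colimit vanishes because representables are compact and
generate `D(A)`. The extensions assemble to a map from the coproduct killed by an isomorphism, so `Q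
M ⟶ X` is zero. Taking `Q M ≅ X` gives `X = 0`. -/

namespace VerdierCompact

/-! ### Coproduct cofans and functors preserving them -/

section Cofans

variable {T : Type*} [Category* T] {I : Type*} {X : I → T}

/-- A cofan is a coproduct if families of morphisms extend to it, in a unique way. -/
noncomputable def cofanIsColimit (c : Cofan X)
    (ex : ∀ (Z : T) (φ : ∀ i, X i ⟶ Z), ∃ g : c.pt ⟶ Z, ∀ i, c.inj i ≫ g = φ i)
    (uniq : ∀ (Z : T) (g h : c.pt ⟶ Z), (∀ i, c.inj i ≫ g = c.inj i ≫ h) → g = h) :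
    IsColimit c :=
  Cofan.IsColimit.mk c (fun s => (ex s.pt s.inj).choose) (fun s => (ex s.pt s.inj).choose_spec)
    (fun s _ hm => uniq _ _ _ fun i => (hm i).trans ((ex s.pt s.inj).choose_spec i).symm)

lemma preservesColimit_of_isColimit_cofan {D : Type*} [Category* D] (F : T ⥤ D) (c : Cofan X)
    (hc : IsColimit c) (h : IsColimit (Cofan.mk (F.obj c.pt) (fun i => F.map (c.inj i)))) :
    PreservesColimit (Discrete.functor X) F := by
  have e : Cofan.mk c.pt c.inj ≅ c := Cofan.ext (Iso.refl _) (by simp)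
  refine preservesColimit_of_preserves_colimit_cocone (hc.ofIsoColimit e.symm) ?_
  exact (isColimitMapCoconeCofanMkEquiv F X c.inj).symm h

/-- A functor preserving coproducts indexed by `I` sends coproduct cofans to coproduct cofans. -/
noncomputable def isColimitCofanMap {D : Type*} [Category* D] (F : T ⥤ D)
    [PreservesColimitsOfShape (Discrete I) F] {c : Cofan X} (hc : IsColimit c) :
    IsColimit (Cofan.mk (F.obj c.pt) (fun i => F.map (c.inj i))) :=
  isColimitMapCoconeCofanMkEquiv F X c.inj
    (isColimitOfPreserves F (hc.ofIsoColimit (Cofan.ext (Iso.refl _) (by simp))))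

end Cofans

/-! ### Compactness as finite factorization -/

section Compact

/-- The images of the summands generate a coproduct of abelian groups. -/
lemma closure_range_inj_eq_top {I : Type*} {G : I → AddCommGrpCat.{w}} {c : Cofan G}
    (hc : IsColimit c) :
    AddSubgroup.closure (⋃ i, Set.range (c.inj i).hom) = ⊤ := by
  set H := AddSubgroup.closure (⋃ i, Set.range (c.inj i).hom) with hH
  -- The quotient map by `H` vanishes on every summand, hence is zero.
  have : AddCommGrpCat.ofHom (QuotientAddGroup.mk' H) = 0 := by
    refine Cofan.IsColimit.hom_ext hc _ _ fun i => ?_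
    ext x
    simp only [AddCommGrpCat.hom_comp, AddCommGrpCat.hom_ofHom, AddMonoidHom.comp_apply,
      comp_zero]
    exact (QuotientAddGroup.eq_zero_iff _).2
      (AddSubgroup.subset_closure (Set.mem_iUnion.2 ⟨i, x, rfl⟩))
  rw [eq_top_iff]
  intro x _
  exact (QuotientAddGroup.eq_zero_iff x).1 (ConcreteCategory.congr_hom this x)

/-- A cofan of abelian groups is a coproduct if it is generated by the images of the summands,
and these images are independent, as witnessed by projections. -/
lemma nonempty_isColimit_cofan_addCommGrp {I : Type*} {G : I → AddCommGrpCat.{w}} (c : Cofan G)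
    (hc : ∀ x : c.pt, ∃ (s : Finset I) (y : ∀ i, G i), x = ∑ i ∈ s, c.inj i (y i))
    (p : ∀ i, c.pt ⟶ G i) (hp : ∀ i x, p i (c.inj i x) = x)
    (hp' : ∀ i j x, i ≠ j → p j (c.inj i x) = 0) : Nonempty (IsColimit c) := by
  classical
  -- The direct sum may live in a larger universe than `c.pt`, so the two are compared by a
  -- bijection rather than inside the category.
  let φ : (DirectSum I fun i => G i) →+ c.pt := DirectSum.toAddMonoid fun i => (c.inj i).hom
  have hφ : ∀ i x, φ (DirectSum.of (fun i => G i) i x) = c.inj i x := fun i x =>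
    DirectSum.toAddMonoid_of _ _ _
  have hpφ : ∀ i x, p i (φ x) = x i := by
    intro i x
    induction x using DirectSum.induction_on with
    | zero => simp
    | of j x =>
      rw [hφ]
      by_cases h : j = i
      · subst h; rw [hp, DirectSum.of_eq_same]
      · rw [hp' _ _ _ h, DirectSum.of_eq_of_ne _ _ _ (Ne.symm h)]
    | add x y hx hy => rw [map_add, map_add, hx, hy, DirectSum.add_apply]
  have bij : Function.Bijective φ := by
    constructor
    · intro x y h
      ext i
      rw [← hpφ, ← hpφ, h]
    · intro x
      obtain ⟨s, y, rfl⟩ := hc x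
      exact ⟨∑ i ∈ s, DirectSum.of (fun i => G i) i (y i), by simp only [map_sum, hφ]⟩
  let e := AddEquiv.ofBijective φ bij
  refine ⟨cofanIsColimit c (fun Z ψ => ?_) (fun Z g h H => ?_)⟩
  · refine ⟨AddCommGrpCat.ofHom
      ((DirectSum.toAddMonoid fun i => (ψ i).hom).comp e.symm.toAddMonoidHom), fun i => ?_⟩
    ext x
    have : e.symm (c.inj i x) = DirectSum.of (fun i => G i) i x := by
      rw [AddEquiv.symm_apply_eq]; exact (hφ i x).symm
    change DirectSum.toAddMonoid (fun i => (ψ i).hom) (e.symm (c.inj i x)) = _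
    rw [this, DirectSum.toAddMonoid_of]
  · ext x
    obtain ⟨s, y, rfl⟩ := hc x
    simp only [map_sum]
    exact Finset.sum_congr rfl fun i _ => ConcreteCategory.congr_hom (H i) (y i)

variable {T : Type v} [Category.{w} T] [Preadditive T]

/-- Every morphism from `C` to a small coproduct is a finite sum of morphisms to the summands. -/
def FactorsFinitely (C : T) : Prop :=
  ∀ (I : Type u) (X : I → T) (c : Cofan X) (_ : IsColimit c) (f : C ⟶ c.pt),
    ∃ (s : Finset I) (g : ∀ i, C ⟶ X i), f = ∑ i ∈ s, g i ≫ c.inj i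

open Classical in
/-- The projections from a coproduct to its summands. -/
noncomputable def cofanProj {I : Type*} {X : I → T} {c : Cofan X} (hc : IsColimit c) (i : I) :
    c.pt ⟶ X i :=
  Cofan.IsColimit.desc hc fun j => if h : j = i then eqToHom (by rw [h]) else 0

lemma inj_cofanProj {I : Type*} {X : I → T} {c : Cofan X} (hc : IsColimit c) (i : I) :
    c.inj i ≫ cofanProj hc i = 𝟙 _ := by
  simp [cofanProj]

lemma inj_cofanProj_of_ne {I : Type*} {X : I → T} {c : Cofan X} (hc : IsColimit c) {i j : I}
    (h : i ≠ j) : c.inj i ≫ cofanProj hc j = 0 := by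
  simp [cofanProj, h]

lemma exists_finset_sum_of_mem_closure {M : Type*} [AddCommGroup M] {I : Type*} {G : I → Type*}
    [∀ i, AddCommGroup (G i)] (φ : ∀ i, G i →+ M) {x : M}
    (hx : x ∈ AddSubgroup.closure (⋃ i, Set.range (φ i))) :
    ∃ (s : Finset I) (y : ∀ i, G i), x = ∑ i ∈ s, φ i (y i) := by
  classical
  have : x ∈ (DirectSum.toAddMonoid φ).range := by
    refine (AddSubgroup.closure_le _).2 ?_ hx
    rintro _ ⟨_, ⟨i, rfl⟩, y, rfl⟩
    exact ⟨DirectSum.of G i y, DirectSum.toAddMonoid_of _ _ _⟩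
  obtain ⟨z, rfl⟩ := this
  refine ⟨DFinsupp.support z, z, ?_⟩
  conv_lhs => rw [← DirectSum.sum_support_of z]
  simp only [map_sum, DirectSum.toAddMonoid_of]

lemma IsCompactObject.factorsFinitely {C : T} (hC : IsCompactObject.{u} C) :
    FactorsFinitely.{u} C := by
  intro I X c hc f
  have := hC I
  have h := closure_range_inj_eq_top
    (isColimitCofanMap (preadditiveCoyoneda.obj (op C)) hc)
  exact exists_finset_sum_of_mem_closure (fun i => ((preadditiveCoyoneda.obj (op C)).map (c.inj i)).hom) (x := f)
    (h.ge (AddSubgroup.mem_top _))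

lemma FactorsFinitely.isCompactObject [HasCoproducts.{u} T] {C : T}
    (hC : FactorsFinitely.{u} C) : IsCompactObject.{u} C := by
  intro I
  suffices ∀ X : I → T, PreservesColimit (Discrete.functor X) (preadditiveCoyoneda.obj (op C)) from
    preservesColimitsOfShape_of_discrete _
  intro X
  have hc := coproductIsCoproduct X
  refine preservesColimit_of_isColimit_cofan _ _ hc (Nonempty.some ?_)
  refine nonempty_isColimit_cofan_addCommGrp _ (fun f => ?_)
    (fun i => (preadditiveCoyoneda.obj (op C)).map (cofanProj hc i)) (fun i x => ?_)
    (fun i j x h => ?_)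
  · exact hC I X _ hc f
  · have (y : C ⟶ X i) : (y ≫ Sigma.ι X i) ≫ cofanProj hc i = y := by
      rw [Category.assoc]
      exact (y ≫= inj_cofanProj hc i).trans (Category.comp_id _)
    exact this x
  · have (y : C ⟶ X i) : (y ≫ Sigma.ι X i) ≫ cofanProj hc j = 0 := by
      rw [Category.assoc]
      exact (y ≫= inj_cofanProj_of_ne hc h).trans comp_zero
    exact this x

end Compact

/-! ### Coproducts in localizations -/

section Localization

variable {C D : Type*} [Category* C] [Category* D] (F : C ⥤ D) (W : MorphismProperty C)
  [F.IsLocalization W] [W.HasLeftCalculusOfFractions] [W.HasRightCalculusOfFractions]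
  {I : Type*} [HasCoproductsOfShape I C]

/-- A family of fractions has denominators in `W`, and their coproduct is again in `W`, so it serves
as a common denominator. Right fractions give existence; for uniqueness, equalities of images are
witnessed by precomposition with morphisms of `W`, which are again combined into one. -/
lemma nonempty_isColimit_cofan_localization
    (hW : ∀ {X Y : I → C} (f : ∀ i, X i ⟶ Y i), (∀ i, W (f i)) → W (Limits.Sigma.map f))
    (X : I → C) :
    Nonempty (IsColimit (Cofan.mk (F.obj (∐ X)) (fun i => F.map (Sigma.ι X i)))) := by
  have := Localization.essSurj F W
  refine ⟨cofanIsColimit _ (fun Z φ => ?_) (fun Z g h H => ?_)⟩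
  · choose α hα using fun i =>
      Localization.exists_rightFraction F W (φ i ≫ (F.objObjPreimageIso Z).inv)
    have := Localization.inverts F W _ (hW (fun i => (α i).s) fun i => (α i).hs)
    refine ⟨inv (F.map (Limits.Sigma.map fun i => (α i).s)) ≫ F.map (Sigma.desc fun i => (α i).f) ≫
      (F.objObjPreimageIso Z).hom, fun i => ?_⟩
    have := Localization.inverts F W _ (α i).hs
    rw [← cancel_mono (F.objObjPreimageIso Z).inv, hα, ← cancel_epi (F.map (α i).s),
      MorphismProperty.RightFraction.map_s_comp_map]
    have e : F.map (α i).s ≫ F.map (Sigma.ι X i) =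
        F.map (Sigma.ι (fun i => (α i).X') i) ≫ F.map (Limits.Sigma.map fun i => (α i).s) := by
      simp only [← F.map_comp, Sigma.ι_map]
    simp only [Cofan.mk_pt, cofan_mk_inj, Category.assoc, Iso.hom_inv_id, Category.comp_id]
    rw [reassoc_of% e, IsIso.hom_inv_id_assoc, ← F.map_comp, Sigma.ι_desc]
  · have : ∀ k : F.obj (∐ X) ⟶ Z, ∃ k', k = k' ≫ (F.objObjPreimageIso Z).hom := fun k =>
      ⟨k ≫ (F.objObjPreimageIso Z).inv, by simp⟩
    dsimp at g h
    obtain ⟨g, rfl⟩ := this g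
    obtain ⟨h, rfl⟩ := this h
    congr 1
    replace H : ∀ i, F.map (Sigma.ι X i) ≫ g = F.map (Sigma.ι X i) ≫ h := fun i => by
      rw [← cancel_mono (F.objObjPreimageIso Z).hom, Category.assoc, Category.assoc]
      exact H i
    obtain ⟨α, rfl⟩ := Localization.exists_leftFraction F W g
    obtain ⟨β, hβ⟩ := Localization.exists_leftFraction F W
      (h ≫ F.map α.s)
    have := Localization.inverts F W _ α.hs
    have := Localization.inverts F W _ β.hs
    rw [← cancel_mono (F.map α.s), ← cancel_mono (F.map β.s), hβ,
      MorphismProperty.LeftFraction.map_comp_map_s, MorphismProperty.LeftFraction.map_comp_map_s,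
      ← F.map_comp]
    have H' : ∀ i, F.map (Sigma.ι X i ≫ α.f ≫ β.s) = F.map (Sigma.ι X i ≫ β.f) := fun i => by
      have := H i =≫ (F.map α.s ≫ F.map β.s)
      simp only [Category.assoc] at this
      rw [reassoc_of% hβ, MorphismProperty.LeftFraction.map_comp_map_s,
        MorphismProperty.LeftFraction.map_comp_map_s_assoc] at this
      simpa using this
    choose Y s hs hs' using fun i => (W.map_eq_iff_precomp F _ _).1 (H' i)
    refine (W.map_eq_iff_precomp F _ _).2 ⟨_, Limits.Sigma.map s, hW s hs, ?_⟩
    refine Sigma.hom_ext _ _ fun i => ?_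
    simpa using hs' i

lemma preservesCoproducts_of_isLocalization
    (hW : ∀ {X Y : I → C} (f : ∀ i, X i ⟶ Y i), (∀ i, W (f i)) → W (Limits.Sigma.map f)) :
    PreservesColimitsOfShape (Discrete I) F := by
  have (X : I → C) : PreservesColimit (Discrete.functor X) F :=
    preservesColimit_of_isColimit_cofan _ _ (coproductIsCoproduct X)
      (nonempty_isColimit_cofan_localization F W hW X).some
  exact preservesColimitsOfShape_of_discrete _

lemma hasCoproducts_of_preservesCoproducts [F.EssSurj] [PreservesColimitsOfShape (Discrete I) F] :
    HasCoproductsOfShape I D :=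
  ⟨fun G => by
    have : HasCoproduct (fun i => F.obj (F.objPreimage (G.obj ⟨i⟩))) :=
      ⟨⟨_, isColimitCofanMap F (coproductIsCoproduct fun i => F.objPreimage (G.obj ⟨i⟩))⟩⟩
    exact hasColimit_of_iso (Discrete.natIso (F := G)
      (G := Discrete.functor fun i => F.obj (F.objPreimage (G.obj ⟨i⟩)))
      fun i => (F.objObjPreimageIso (G.obj i)).symm)⟩

end Localization

/-! ### Coproducts of morphisms with cone in `L` -/

section Triangulated

open Pretriangulated Pretriangulated.Opposite

variable {C : Type*} [Category* C] [HasZeroObject C] [HasShift C ℤ]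
  [Preadditive C] [∀ (n : ℤ), (shiftFunctor C n).Additive] [Pretriangulated C]
  {I : Type*} [HasCoproductsOfShape I C]

/-- A triangulated subcategory closed under coproducts induces a class of morphisms closed under
coproducts. -/
lemma trW_sigmaMap (L : ObjectProperty C) [L.IsTriangulated]
    [L.IsClosedUnderColimitsOfShape (Discrete I)] {X Y : I → C} (f : ∀ i, X i ⟶ Y i)
    (hf : ∀ i, L.trW (f i)) : L.trW (Limits.Sigma.map f) := by
  -- The coproduct becomes a product in the opposite category, where a product of distinguished
  -- triangles is distinguished; its third object is the product of the cones, which lies in `L.op`.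
  have : HasProductsOfShape I Cᵒᵖ := inferInstance
  have : L.IsClosedUnderColimitsOfShape (Discrete I)ᵒᵖ :=
    .of_equivalence (Discrete.opposite I).symm
  have hf' : ∀ i, L.op.trW (f i).op := fun i => (L.trW_op_iff).2 (hf i)
  have h : L.op.trW (Limits.Pi.map fun i => (f i).op) := ObjectProperty.trW.mk _
    (productTriangle_distinguished _
      (fun j => (hf' j).choose_spec.choose_spec.choose_spec.choose))
    (L.op.prop_pi _ (fun j => (hf' j).choose_spec.choose_spec.choose_spec.choose_spec))
  refine (L.trW_op_iff (f := (Limits.Sigma.map f).op)).1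
    ((MorphismProperty.arrow_mk_iso_iff _ ?_).1 h)
  refine Arrow.isoMk (opCoproductIsoProduct Y).symm (opCoproductIsoProduct X).symm ?_
  rw [← cancel_epi (opCoproductIsoProduct Y).hom, ← cancel_mono (opCoproductIsoProduct X).hom]
  refine Limits.Pi.hom_ext _ _ fun i => ?_
  simp [← op_comp]

end Triangulated

/-! ### Transport of finite factorization along functors -/

section FactorsFinitely

variable {T D : Type*} [Category* T] [Category* D] [Preadditive T] [Preadditive D]

/-- The target coproduct is the image of a coproduct in `T`, so the morphism lifts to `T`, where it
splits. Only fullness on morphisms out of `C` is needed, which fits K-projective sources in the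
derived category. -/
lemma FactorsFinitely.map [HasCoproducts.{u} T] (F : T ⥤ D) [F.Additive] [F.EssSurj]
    [∀ I : Type u, PreservesColimitsOfShape (Discrete I) F] {C : T} (hC : FactorsFinitely.{u} C)
    (hF : ∀ L, Function.Surjective (F.map : (C ⟶ L) → (F.obj C ⟶ F.obj L))) :
    FactorsFinitely.{u} (F.obj C) := by
  intro I X c hc f
  let L : I → T := fun i => F.objPreimage (X i)
  let e : ∀ i, F.obj (L i) ≅ X i := fun i => F.objObjPreimageIso (X i)
  have hL := isColimitCofanMap F (coproductIsCoproduct L)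
  let a : c.pt ⟶ F.obj (∐ L) := Cofan.IsColimit.desc hc fun i => (e i).inv ≫ F.map (Sigma.ι L i)
  let b : F.obj (∐ L) ⟶ c.pt := Cofan.IsColimit.desc hL fun i => (e i).hom ≫ c.inj i
  have hb (i : I) : F.map (Sigma.ι L i) ≫ b = (e i).hom ≫ c.inj i := Cofan.IsColimit.fac hL _ _
  have hab : a ≫ b = 𝟙 _ := Cofan.IsColimit.hom_ext hc _ _ fun i => by
    simp [a, hb]
  obtain ⟨g, hg⟩ := hF _ (f ≫ a)
  obtain ⟨s, y, rfl⟩ := hC I L _ (coproductIsCoproduct L) g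
  refine ⟨s, fun i => F.map (y i) ≫ (e i).hom, ?_⟩
  rw [← Category.comp_id f, ← hab, ← Category.assoc, ← hg, F.map_sum, Preadditive.sum_comp]
  refine Finset.sum_congr rfl fun i _ => ?_
  rw [F.map_comp, Category.assoc, Category.assoc, ← hb]
  rfl

end FactorsFinitely

/-! ### Coproducts in homotopy and derived categories -/

section Complexes

variable {C : Type*} [Category* C]

section

variable [Preadditive C] {ι : Type*} {c : ComplexShape ι}

lemma nullHomotopicMap_hom {K L : HomologicalComplex C c} {f : K ⟶ L} (h : Homotopy f 0) :
    Homotopy.nullHomotopicMap h.hom = f := by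
  ext i
  simp [Homotopy.nullHomotopicMap, h.comm i]

variable {I : Type*} [HasCoproductsOfShape I C]

/-- Coproducts of complexes are computed degreewise, so chosen null homotopies on the summands glue
to one on the coproduct. -/
lemma quotient_map_eq_zero_of_coproduct (K : I → HomologicalComplex C c)
    {L : HomologicalComplex C c} (f : ∐ K ⟶ L)
    (hf : ∀ i, (HomotopyCategory.quotient C c).map (Sigma.ι K i ≫ f) = 0) :
    (HomotopyCategory.quotient C c).map f = 0 := by
  have h : ∀ i, Homotopy (Sigma.ι K i ≫ f) 0 := fun i =>
    HomotopyCategory.homotopyOfEq _ _ (by rw [hf, Functor.map_zero])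
  have hK (p : ι) := isColimitCofanMap (HomologicalComplex.eval C c p) (coproductIsCoproduct K)
  let H : ∀ p q, (∐ K).X p ⟶ L.X q := fun p q =>
    Cofan.IsColimit.desc (hK p) fun i => (h i).hom p q
  have hH (i : I) (p q : ι) : (Sigma.ι K i).f p ≫ H p q = (h i).hom p q :=
    Cofan.IsColimit.fac (hK p) _ _
  have : f = Homotopy.nullHomotopicMap H := Sigma.hom_ext _ _ fun i => by
    rw [Homotopy.comp_nullHomotopicMap, ← nullHomotopicMap_hom (h i)]
    simp only [hH]
  rw [this, HomotopyCategory.eq_of_homotopy _ _ (Homotopy.nullHomotopy H fun p q hpq =>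
    Cofan.IsColimit.hom_ext (hK p) _ _ fun i => ?_), Functor.map_zero]
  exact (hH i p q).trans (((h i).zero p q hpq).trans comp_zero.symm)

instance preservesCoproducts_quotient :
    PreservesColimitsOfShape (Discrete I) (HomotopyCategory.quotient C c) := by
  have (K : I → HomologicalComplex C c) :
      PreservesColimit (Discrete.functor K) (HomotopyCategory.quotient C c) := by
    refine preservesColimit_of_isColimit_cofan _ _ (coproductIsCoproduct K)
      (cofanIsColimit _ (fun Z φ => ?_) (fun Z g h H => ?_))
    · obtain ⟨Z, rfl⟩ := HomotopyCategory.quotient_obj_surjective Z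
      choose ψ hψ using fun i => (HomotopyCategory.quotient C c).map_surjective (φ i)
      refine ⟨(HomotopyCategory.quotient C c).map (Sigma.desc ψ), fun i => ?_⟩
      refine ((HomotopyCategory.quotient C c).map_comp _ _).symm.trans ?_
      rw [← hψ]
      exact congrArg _ (Sigma.ι_desc _ _)
    · obtain ⟨Z, rfl⟩ := HomotopyCategory.quotient_obj_surjective Z
      obtain ⟨g, rfl⟩ := (HomotopyCategory.quotient C c).map_surjective g
      obtain ⟨h, rfl⟩ := (HomotopyCategory.quotient C c).map_surjective h
      rw [← sub_eq_zero, ← Functor.map_sub]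
      refine quotient_map_eq_zero_of_coproduct K _ fun i => ?_
      rw [Preadditive.comp_sub, Functor.map_sub, sub_eq_zero, Functor.map_comp, Functor.map_comp]
      exact H i
  exact preservesColimitsOfShape_of_discrete _

instance hasCoproducts_homotopyCategory : HasCoproductsOfShape I (HomotopyCategory C c) :=
  hasCoproducts_of_preservesCoproducts (HomotopyCategory.quotient C c)

lemma factorsFinitely_single [HasZeroObject C] [DecidableEq ι] [HasCoproducts.{u} C] {G : C}
    (hG : FactorsFinitely.{u} G) (n : ι) :
    FactorsFinitely.{u} ((HomologicalComplex.single C c n).obj G) := by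
  intro I X t ht f
  have hn := isColimitCofanMap (HomologicalComplex.eval C c n) ht
  obtain ⟨s, (g : ∀ i, G ⟶ (X i).X n), (hg : _ = ∑ i ∈ s, g i ≫ (t.inj i).f n)⟩ :=
    hG I _ _ hn ((HomologicalComplex.singleObjXSelf c n G).inv ≫ f.f n)
  -- `E` projects onto the finitely many summands met in degree `n`. Since `f = f ≫ E` can be tested
  -- in that degree, there is no need to check that the `g i` define chain maps.
  let E : t.pt ⟶ t.pt := ∑ i ∈ s, cofanProj ht i ≫ t.inj i
  have hE (j : I) (hj : j ∈ s) : t.inj j ≫ E = t.inj j := by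
    rw [Preadditive.comp_sum, Finset.sum_eq_single_of_mem j hj fun i _ hi => ?_]
    · rw [← Category.assoc, inj_cofanProj, Category.id_comp]
    · rw [← Category.assoc, inj_cofanProj_of_ne _ hi.symm, zero_comp]
  refine ⟨s, fun i => f ≫ cofanProj ht i, HomologicalComplex.from_single_hom_ext ?_⟩
  have hk (k : G ⟶ t.pt.X n) (hk : k = ∑ i ∈ s, g i ≫ (t.inj i).f n) : k = k ≫ E.f n := by
    rw [hk, Preadditive.sum_comp]
    refine Finset.sum_congr rfl fun j hj => ?_
    rw [Category.assoc, ← HomologicalComplex.comp_f, hE j hj]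
  have : f.f n = f.f n ≫ E.f n := by
    rw [← cancel_epi (HomologicalComplex.singleObjXSelf c n G).inv]
    exact (hk _ hg).trans (Category.assoc _ _ _)
  rw [this, ← HomologicalComplex.comp_f, Preadditive.comp_sum]
  simp only [Category.assoc]

lemma factorsFinitely_quotient_single [HasZeroObject C] [DecidableEq ι] [HasCoproducts.{u} C]
    {G : C} (hG : FactorsFinitely.{u} G) (n : ι) :
    FactorsFinitely.{u}
      ((HomotopyCategory.quotient C c).obj ((HomologicalComplex.single C c n).obj G)) :=
  (factorsFinitely_single hG n).map _ fun _ => Functor.map_surjective _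

instance small_hom_quotient_single [HasZeroObject C] [DecidableEq ι] {G : C}
    [∀ M : C, Small.{u} (G ⟶ M)] (n : ι) (L : HomotopyCategory C c) :
    Small.{u} ((HomotopyCategory.quotient C c).obj ((HomologicalComplex.single C c n).obj G) ⟶ L) := by
  obtain ⟨L, rfl⟩ := HomotopyCategory.quotient_obj_surjective L
  have : Small.{u} ((HomologicalComplex.single C c n).obj G ⟶ L) :=
    small_of_injective (β := G ⟶ L.X n)
      (f := fun f => (HomologicalComplex.singleObjXSelf c n G).inv ≫ f.f n) fun f g h =>
      HomologicalComplex.from_single_hom_ext ((cancel_epi _).1 h)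
  exact small_of_surjective (HomotopyCategory.quotient C c).map_surjective

end

section Abelian

variable [Abelian C] {J : Type*} (G : J → C)

instance isKProjective_single (P : C) [Projective P] (n : ℤ) :
    CochainComplex.IsKProjective ((HomologicalComplex.single C (.up ℤ) n).obj P) := by
  have (i : ℤ) : Projective (((HomologicalComplex.single C (.up ℤ) n).obj P).X i) := by
    by_cases h : i = n
    · exact Projective.of_iso (HomologicalComplex.singleObjXIsoOfEq _ n P i h).symm inferInstance
    · have := (HomologicalComplex.isZero_single_obj_X (.up ℤ) n P i h)
      exact Projective.of_iso this.isoZero.symm inferInstance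
  have : CochainComplex.IsStrictlyLE ((HomologicalComplex.single C (.up ℤ) n).obj P) n :=
    inferInstance
  exact CochainComplex.isKProjective_of_projective _ n

variable (hG : ∀ {X Y : C} (f g : X ⟶ Y), (∀ j (x : G j ⟶ X), x ≫ f = x ≫ g) → f = g)

include hG in
/-- Exactness can be tested on morphisms from separating objects. -/
lemma exact_of_separating (S : ShortComplex C)
    (hS : ∀ j (x : G j ⟶ S.X₂), x ≫ S.g = 0 → ∃ y : G j ⟶ S.X₁, y ≫ S.f = x) : S.Exact := by
  rw [ShortComplex.exact_iff_epi_toCycles]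
  refine ⟨fun f g hfg => hG f g fun j x => ?_⟩
  obtain ⟨y, hy⟩ := hS j (x ≫ S.iCycles) (by simp)
  obtain rfl : y ≫ S.toCycles = x := by simpa [← cancel_mono S.iCycles] using hy
  rw [Category.assoc, Category.assoc, hfg]

include hG in
/-- Acyclic complexes can be detected on morphisms from shifts of separating projectives. -/
lemma subcategoryAcyclic_iff_of_separating [∀ j, Projective (G j)]
    (L : HomotopyCategory C (.up ℤ)) :
    HomotopyCategory.subcategoryAcyclic C L ↔ ∀ (j : J) (n : ℤ)
      (f : (HomotopyCategory.quotient C _).obj ((HomologicalComplex.single C _ n).obj (G j)) ⟶ L),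
      f = 0 := by
  refine ⟨fun h j n f => CochainComplex.IsKProjective.leftOrthogonal _ f h, fun h => ?_⟩
  obtain ⟨L, rfl⟩ := HomotopyCategory.quotient_obj_surjective L
  rw [HomotopyCategory.quotient_obj_mem_subcategoryAcyclic_iff_exactAt]
  intro n
  rw [L.exactAt_iff' (n - 1) n (n + 1) (by simp) (by simp)]
  refine exact_of_separating G hG _ fun j (x : G j ⟶ L.X n) (hx : x ≫ L.d n (n + 1) = 0) => ?_
  -- A cycle is a chain map from a single complex, and a null homotopy of that map exhibits the
  -- cycle as a boundary.
  let φ : (HomologicalComplex.single C (.up ℤ) n).obj (G j) ⟶ L :=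
    HomologicalComplex.mkHomFromSingle x fun k hk => by
      obtain rfl : n + 1 = k := hk
      exact hx
  obtain ⟨H⟩ := (HomotopyCategory.quotient_map_eq_zero_iff φ).1 (h j n _)
  have hφ := H.comm n
  rw [prevD_eq (j' := n - 1) _ (by simp), dNext_eq (i' := n + 1) _ (by simp)] at hφ
  simp only [HomologicalComplex.single_obj_d, zero_comp, zero_add, HomologicalComplex.zero_f,
    add_zero, φ, HomologicalComplex.mkHomFromSingle_f] at hφ
  refine ⟨(HomologicalComplex.singleObjXSelf (.up ℤ) n (G j)).inv ≫ H.hom n (n - 1), ?_⟩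
  change (_ ≫ _) ≫ L.d (n - 1) n = x
  rw [Category.assoc, ← hφ, Iso.inv_hom_id_assoc]

section Derived

variable [HasDerivedCategory.{w} C]

/-- K-projectivity represents these morphisms in the homotopy category. Smallness is what allows the
coproduct over all of them in `exists_extension`. -/
instance small_hom_singleFunctor (P : C) [Projective P] [∀ M : C, Small.{u} (P ⟶ M)]
    (n : ℤ) (M : DerivedCategory C) :
    Small.{u} ((DerivedCategory.singleFunctor C n).obj P ⟶ M) := by
  let L := DerivedCategory.Qh.objPreimage M
  let e : DerivedCategory.Qh.obj L ≅ M := DerivedCategory.Qh.objObjPreimageIso M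
  refine small_of_surjective (f := fun f : (HomotopyCategory.quotient C _).obj
    ((HomologicalComplex.single C _ n).obj P) ⟶ L => DerivedCategory.Qh.map f ≫ e.hom) fun f => ?_
  obtain ⟨g, hg⟩ := (CochainComplex.IsKProjective.Qh_map_bijective
    ((HomologicalComplex.single C _ n).obj P) L).surjective (f ≫ e.inv)
  refine ⟨g, (hg =≫ e.hom).trans ?_⟩
  exact (Category.assoc _ _ _).trans ((f ≫= e.inv_hom_id).trans (Category.comp_id f))

-- By K-projectivity the hypothesis passes to a complex representing `M`, which is then acyclic.
open ZeroObject in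
include hG in
lemma isZero_of_forall_singleFunctor [∀ j, Projective (G j)] (M : DerivedCategory C)
    (hM : ∀ j n (f : (DerivedCategory.singleFunctor C n).obj (G j) ⟶ M), f = 0) : IsZero M := by
  let L := DerivedCategory.Qh.objPreimage M
  let e : DerivedCategory.Qh.obj L ≅ M := DerivedCategory.Qh.objObjPreimageIso M
  have hL : HomotopyCategory.subcategoryAcyclic C L := by
    rw [subcategoryAcyclic_iff_of_separating G hG]
    intro j n f
    refine (CochainComplex.IsKProjective.Qh_map_bijective _ L).injective ?_
    rw [Functor.map_zero, ← cancel_mono e.hom, zero_comp]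
    exact hM j n _
  let Z : HomotopyCategory C (.up ℤ) := 0
  have : (HomotopyCategory.subcategoryAcyclic C).trW (0 : Z ⟶ L) :=
    ObjectProperty.trW.mk _ (Pretriangulated.contractible_distinguished₁ L) hL
  have := Localization.inverts DerivedCategory.Qh _ _ this
  exact ((Functor.map_isZero _ (isZero_zero _)).of_iso
    (asIso (DerivedCategory.Qh.map (0 : Z ⟶ L))).symm).of_iso e.symm

end Derived

variable [HasCoproducts.{u} C] (hfin : ∀ j, FactorsFinitely.{u} (G j))

include hG hfin in
/-- Acyclic complexes are closed under coproducts if there are enough compact projectives. -/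
lemma isClosedUnderCoproducts_subcategoryAcyclic [∀ j, Projective (G j)] (I : Type u) :
    (HomotopyCategory.subcategoryAcyclic C).IsClosedUnderColimitsOfShape (Discrete I) where
  colimitsOfShape_le := by
    rintro X ⟨p⟩
    rw [subcategoryAcyclic_iff_of_separating G hG]
    intro j n f
    let c : Cofan (fun i => p.diag.obj ⟨i⟩) := Cofan.mk X fun i => p.ι.app ⟨i⟩
    have hc : IsColimit c := cofanIsColimit _
      (fun Z φ => ⟨p.isColimit.desc (Cocone.mk Z (Discrete.natTrans fun i => φ i.as)), fun i =>
        p.isColimit.fac _ _⟩)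
      (fun Z g h H => p.isColimit.hom_ext fun i => H i.as)
    obtain ⟨s, y, rfl⟩ := factorsFinitely_quotient_single (hfin j) n I _ c hc f
    refine Finset.sum_eq_zero fun i _ => ?_
    rw [(subcategoryAcyclic_iff_of_separating G hG _).1 (p.prop_diag_obj ⟨i⟩) j n (y i), zero_comp]

section Derived

variable [HasDerivedCategory.{w} C] [∀ j, Projective (G j)]

include hG hfin in
lemma preservesCoproducts_Qh (I : Type u) :
    PreservesColimitsOfShape (Discrete I) (DerivedCategory.Qh (C := C)) := by
  have := isClosedUnderCoproducts_subcategoryAcyclic G hG hfin I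
  exact preservesCoproducts_of_isLocalization _ (HomotopyCategory.subcategoryAcyclic C).trW
    (trW_sigmaMap _)

include hG hfin in
lemma hasCoproducts_derivedCategory : HasCoproducts.{u} (DerivedCategory C) := fun I => by
  have := preservesCoproducts_Qh G hG hfin I
  exact hasCoproducts_of_preservesCoproducts DerivedCategory.Qh

include hG hfin in
lemma factorsFinitely_singleFunctor (j : J) (n : ℤ) :
    FactorsFinitely.{u} ((DerivedCategory.singleFunctor C n).obj (G j)) := by
  have := preservesCoproducts_Qh G hG hfin
  exact (factorsFinitely_quotient_single (hfin j) n).map DerivedCategory.Qh fun L =>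
    (CochainComplex.IsKProjective.Qh_map_bijective _ L).surjective

end Derived

end Abelian

end Complexes

/-! ### Killing maps from generators along a telescope -/

section Devissage

open Pretriangulated

variable {T T' : Type*} [Category* T] [Category* T'] [Preadditive T] [Preadditive T']
  [HasZeroObject T] [HasShift T ℤ] [∀ n : ℤ, (shiftFunctor T n).Additive] [Pretriangulated T]
  {J : Type u} {S : J → T}

/-- If a family `S`, stable under shifts, detects zero objects, and composing morphisms from `S`
with `q : X ⟶ X` gives zero, then `𝟙 X - q` is an isomorphism. -/
lemma isIso_id_sub_of_comp_eq_zero (hshift : ∀ j, ∃ j', Nonempty ((S j')⟦(1 : ℤ)⟧ ≅ S j))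
    (hS : ∀ M : T, (∀ j (f : S j ⟶ M), f = 0) → IsZero M) {X : T} (q : X ⟶ X)
    (hq : ∀ j (f : S j ⟶ X), f ≫ q = 0) : IsIso (𝟙 X - q) := by
  obtain ⟨Z, g, h, mem⟩ := distinguished_cocone_triangle (𝟙 X - q)
  refine (Triangle.isZero₃_iff_isIso₁ _ mem).1 (hS _ fun j (f : S j ⟶ Z) => ?_)
  have hfh : f ≫ h = 0 := by
    obtain ⟨j', ⟨e⟩⟩ := hshift j
    obtain ⟨k, hk⟩ := (shiftFunctor T (1 : ℤ)).map_surjective (e.hom ≫ f ≫ h)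
    have h₁ : h ≫ (𝟙 X - q)⟦(1 : ℤ)⟧' = 0 := comp_distTriang_mor_zero₃₁ _ mem
    have h₂ : k ≫ (𝟙 X - q) = 0 := (shiftFunctor T (1 : ℤ)).map_injective (by
      rw [Functor.map_comp, hk, Functor.map_zero, Category.assoc, Category.assoc, h₁, comp_zero,
        comp_zero])
    rw [Preadditive.comp_sub, hq, sub_zero, Category.comp_id] at h₂
    rw [← cancel_epi e.hom, comp_zero, ← hk, h₂, Functor.map_zero]
  obtain ⟨(k : S j ⟶ X), (hk : f = k ≫ g)⟩ := Triangle.coyoneda_exact₃ _ mem f hfh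
  have h₀ : (𝟙 X - q) ≫ g = 0 := comp_distTriang_mor_zero₁₂ _ mem
  have : k = k ≫ (𝟙 X - q) := by simp [Preadditive.comp_sub, hq]
  exact hk.trans ((this =≫ g).trans ((Category.assoc _ _ _).trans ((k ≫= h₀).trans comp_zero)))

variable [HasCoproducts.{u} T] (F : T ⥤ T')
  [∀ I : Type u, PreservesColimitsOfShape (Discrete I) F]

/-- Compatible morphisms to `X` from the images of a sequence are zero if morphisms from `S`
die in the sequence. -/
lemma eq_zero_of_sequence [F.Additive]
    (hshift : ∀ j, ∃ j', Nonempty ((S j')⟦(1 : ℤ)⟧ ≅ S j))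
    (hS : ∀ M : T, (∀ j (f : S j ⟶ M), f = 0) → IsZero M)
    (hfin : ∀ j, FactorsFinitely.{u} (S j))
    (M : ℕ → T) (φ : ∀ n, M n ⟶ M (n + 1)) (hφ : ∀ n j (f : S j ⟶ M n), f ≫ φ n = 0)
    {X : T'} (f : ∀ n, F.obj (M n) ⟶ X) (hf : ∀ n, F.map (φ n) ≫ f (n + 1) = f n) (n : ℕ) :
    f n = 0 := by
  let N : ULift.{u} ℕ → T := fun n => M n.down
  -- `q` is the telescope shift: the cone of `𝟙 - q` is the homotopy colimit of the sequence, and it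
  -- vanishes because a map from `S j` meets finitely many summands, on each of which `q` kills it.
  let q : ∐ N ⟶ ∐ N := Sigma.desc fun n => φ n.down ≫ Sigma.ι N ⟨n.down + 1⟩
  have hιq (n : ULift.{u} ℕ) : Sigma.ι N n ≫ q = φ n.down ≫ Sigma.ι N ⟨n.down + 1⟩ :=
    Sigma.ι_desc _ _
  have : IsIso (𝟙 _ - q) := isIso_id_sub_of_comp_eq_zero hshift hS q fun j g => by
    obtain ⟨s, y, rfl⟩ := hfin j _ N _ (coproductIsCoproduct N) g
    rw [Preadditive.sum_comp]
    refine Finset.sum_eq_zero fun i _ => ?_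
    have : (Cofan.mk _ (Sigma.ι N)).inj i ≫ q = φ i.down ≫ Sigma.ι N ⟨i.down + 1⟩ := hιq i
    rw [Category.assoc, this]
    exact (Category.assoc _ _ _).symm.trans ((hφ _ _ (y i) =≫ _).trans zero_comp)
  have hc := isColimitCofanMap F (coproductIsCoproduct N)
  let g : F.obj (∐ N) ⟶ X := Cofan.IsColimit.desc hc fun n => f n.down
  have hg (n : ULift.{u} ℕ) : F.map (Sigma.ι N n) ≫ g = f n.down :=
    Cofan.IsColimit.fac hc _ _
  -- This is exactly the compatibility `hf` of the `f n`.
  have : F.map (𝟙 _ - q) ≫ g = 0 := by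
    refine Cofan.IsColimit.hom_ext hc _ _ fun n => ?_
    change F.map (Sigma.ι N n) ≫ F.map (𝟙 _ - q) ≫ g = F.map (Sigma.ι N n) ≫ 0
    rw [← F.map_comp_assoc, Preadditive.comp_sub, hιq, Category.comp_id, F.map_sub,
      Preadditive.sub_comp, F.map_comp, Category.assoc, hg, hg, hf, sub_self, comp_zero]
  have : g = 0 := by rwa [← cancel_epi (F.map (𝟙 _ - q)), comp_zero]
  rw [← hg ⟨n⟩, this, comp_zero]

variable [HasZeroObject T'] [HasShift T' ℤ] [∀ n : ℤ, (shiftFunctor T' n).Additive]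
  [Pretriangulated T'] [F.CommShift ℤ] [F.IsTriangulated]

/-- Any `M` maps to an object in which all morphisms from `S` to `M` die, and to which morphisms
to `X` extend. -/
lemma exists_extension [∀ j (M : T), Small.{u} (S j ⟶ M)] {X : T'}
    (hX : ∀ j (f : F.obj (S j) ⟶ X), f = 0) (M : T) :
    ∃ (N : T) (φ : M ⟶ N), (∀ j (f : S j ⟶ M), f ≫ φ = 0) ∧
      ∀ f : F.obj M ⟶ X, ∃ g : F.obj N ⟶ X, F.map φ ≫ g = f := by
  let P : (Σ j, Shrink.{u} (S j ⟶ M)) → T := fun i => S i.1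
  let a : ∐ P ⟶ M := Sigma.desc fun i => (equivShrink _).symm i.2
  obtain ⟨N, φ, h, mem⟩ := distinguished_cocone_triangle a
  have h₀ : a ≫ φ = 0 := comp_distTriang_mor_zero₁₂ _ mem
  refine ⟨N, φ, fun j f => ?_, fun f => ?_⟩
  · have : f = Sigma.ι P ⟨j, equivShrink _ f⟩ ≫ a := by simp [a, P]
    rw [this, Category.assoc, h₀, comp_zero]
  -- The obstruction to extending `f` over the cone is a family of maps from the `F.obj (S j)` to
  -- `X`, all zero.
  · have : F.map a ≫ f = 0 :=
      Cofan.IsColimit.hom_ext (isColimitCofanMap F (coproductIsCoproduct P)) _ _ fun i =>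
        (hX _ _).trans (hX _ _).symm
    obtain ⟨g, hg⟩ := Triangle.yoneda_exact₂ _ (F.map_distinguished _ mem) f this
    exact ⟨g, hg.symm⟩

/-- If a small family `S` of compact objects, stable under shifts, detects zero objects in `T`,
and `X` receives no nonzero morphism from the images of objects in `S` under a triangulated functor
preserving coproducts, then it receives no nonzero morphism from the image of any object. -/
lemma eq_zero_of_generates [∀ j (M : T), Small.{u} (S j ⟶ M)]
    (hshift : ∀ j, ∃ j', Nonempty ((S j')⟦(1 : ℤ)⟧ ≅ S j))
    (hS : ∀ M : T, (∀ j (f : S j ⟶ M), f = 0) → IsZero M)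
    (hfin : ∀ j, FactorsFinitely.{u} (S j)) {X : T'}
    (hX : ∀ j (f : F.obj (S j) ⟶ X), f = 0) {M : T} (f : F.obj M ⟶ X) : f = 0 := by
  choose next φ hφ ext hext using exists_extension F hX
  let seq : ℕ → T := fun n => Nat.rec M (fun _ => next) n
  let g : ∀ n, F.obj (seq n) ⟶ X := fun n => Nat.rec f (fun n h => ext (seq n) h) n
  exact eq_zero_of_sequence F hshift hS hfin seq (fun n => φ (seq n)) (fun n => hφ (seq n))
    g (fun n => hext _ _) 0

end Devissage

/-! ### Representables are compact projective separators -/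

section RightModules

variable (K : Type u) [CommRing K] (A : Type v) [Category.{u} A] [Preadditive A] [Linear K A]

instance isClosedUnderColimits_isLinear (J : Type*) [Category* J]
    [HasColimitsOfShape J (ModuleCat.{u} K)] :
    (isLinear K A).IsClosedUnderColimitsOfShape J where
  colimitsOfShape_le := by
    rintro F ⟨c⟩
    let ι (j : J) : c.diag.obj j ⟶ F := c.ι.app j
    have hc (Y : Aᵒᵖ) {Z : ModuleCat.{u} K} {a b : F.obj Y ⟶ Z}
        (h : ∀ j, (ι j).app Y ≫ a = (ι j).app Y ≫ b) : a = b :=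
      (isColimitOfPreserves ((evaluation Aᵒᵖ (ModuleCat.{u} K)).obj Y) c.isColimit).hom_ext h
    refine ⟨⟨fun {X Y f g} => hc X fun j => ?_⟩, fun {X Y} r f => hc (op Y) fun j => ?_⟩
    · have := (c.prop_diag_obj j).1
      rw [← NatTrans.naturality, Functor.map_add, Preadditive.comp_add, Preadditive.add_comp,
        NatTrans.naturality, NatTrans.naturality]
    · rw [← NatTrans.naturality, (c.prop_diag_obj j).2, Linear.comp_smul, Linear.smul_comp,
        NatTrans.naturality]

variable {K A}

/-- The element of a right module corresponding to a morphism from a representable module. -/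
def yonEval {a : A} {M : RightMod K A} (f : (yon K A).obj a ⟶ M) : M.obj.obj (op a) :=
  (f.hom.app (op a)).hom (𝟙 a)

lemma yonEval_comp {a : A} {M N : RightMod K A} (f : (yon K A).obj a ⟶ M) (g : M ⟶ N) :
    yonEval (f ≫ g) = (g.hom.app (op a)).hom (yonEval f) := rfl

lemma yonEval_injective {a : A} {M : RightMod K A} :
    Function.Injective (yonEval : ((yon K A).obj a ⟶ M) → _) := by
  intro f g h
  ext Y (y : Y.unop ⟶ a)
  have key (f : (yon K A).obj a ⟶ M) :
      (f.hom.app Y).hom y = (M.obj.map y.op).hom (yonEval f) := by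
    have := ConcreteCategory.congr_hom (f.hom.naturality y.op) (𝟙 a)
    refine Eq.trans ?_ this
    exact congrArg (f.hom.app Y).hom (Category.comp_id y).symm
  exact (key f).trans (h ▸ (key g).symm)

lemma yonEval_surjective {a : A} {M : RightMod K A} :
    Function.Surjective (yonEval : ((yon K A).obj a ⟶ M) → _) := by
  intro x
  have := M.property.1
  let φ (Y : Aᵒᵖ) : ((linearYoneda K A).obj a).obj Y ⟶ M.obj.obj Y :=
    ModuleCat.ofHom
      { toFun := fun f : Y.unop ⟶ a => (M.obj.map f.op).hom x
        map_add' := fun f g => by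
          rw [op_add, Functor.map_add]; rfl
        map_smul' := fun r f => by
          rw [M.property.2]; rfl }
  refine ⟨ObjectProperty.homMk { app := φ, naturality := fun X Y g => ?_ }, ?_⟩
  · ext (f : X.unop ⟶ a)
    change (M.obj.map (g.unop ≫ f).op).hom x = (M.obj.map g).hom ((M.obj.map f.op).hom x)
    rw [op_comp, Functor.map_comp]
    rfl
  · change (M.obj.map (𝟙 (op a))).hom x = x
    rw [CategoryTheory.Functor.map_id]
    rfl

lemma yonEval_sum {a : A} {M : RightMod K A} {I : Type*} (s : Finset I)
    (f : I → ((yon K A).obj a ⟶ M)) : yonEval (∑ i ∈ s, f i) = ∑ i ∈ s, yonEval (f i) := by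
  let φ : ((yon K A).obj a ⟶ M) →+ M.obj.obj (op a) :=
    { toFun := yonEval, map_zero' := rfl, map_add' := fun _ _ => rfl }
  exact map_sum φ f s

/-- Representable modules are separating. -/
lemma rightMod_hom_ext {M N : RightMod K A} (f g : M ⟶ N)
    (h : ∀ (a : A) (x : (yon K A).obj a ⟶ M), x ≫ f = x ≫ g) : f = g := by
  ext Y y
  obtain ⟨x, rfl⟩ := yonEval_surjective y
  exact congrArg yonEval (h _ x)

/-- The cokernel of the underlying natural transformation is again linear, so it can be tested
inside the full subcategory. Epimorphisms of modules are therefore pointwise surjective, as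
projectivity of representables requires. -/
lemma epi_hom_of_epi {M N : RightMod K A} (f : M ⟶ N) [Epi f] : Epi f.hom := by
  refine Preadditive.epi_of_isZero_cokernel _ ?_
  let C : RightMod K A := ⟨cokernel f.hom, isLinear_of_epi K A (cokernel.π f.hom) N.property⟩
  let π : N ⟶ C := ObjectProperty.homMk (cokernel.π f.hom)
  have : π = 0 := by
    rw [← cancel_epi f, comp_zero]
    ext : 1
    exact cokernel.condition f.hom
  have hπ : cokernel.π f.hom = 0 := congrArg InducedCategory.Hom.hom this
  rw [IsZero.iff_id_eq_zero, ← cancel_epi (cokernel.π f.hom), hπ, zero_comp, zero_comp]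

instance projective_yon (a : A) : Projective ((yon K A).obj a) where
  factors {M N} f e _ := by
    have := epi_hom_of_epi e
    have : Epi (e.hom.app (op a)) := inferInstance
    obtain ⟨x, hx⟩ := (ModuleCat.epi_iff_surjective _).1 this (yonEval f)
    obtain ⟨g, rfl⟩ := yonEval_surjective x
    exact ⟨g, yonEval_injective hx⟩

instance small_hom_yon (a : A) (M : RightMod K A) : Small.{u} ((yon K A).obj a ⟶ M) :=
  small_of_injective yonEval_injective

/-- Representable modules are compact. -/
lemma factorsFinitely_yon (a : A) : FactorsFinitely.{u} ((yon K A).obj a) := by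
  intro I X c hc f
  -- By Yoneda, `f` is an element of the coproduct evaluated at `a`, and evaluation preserves
  -- coproducts.
  let E : RightMod K A ⥤ AddCommGrpCat.{u} := (isLinear K A).ι ⋙
    (evaluation Aᵒᵖ (ModuleCat.{u} K)).obj (op a) ⋙ forget₂ (ModuleCat.{u} K) AddCommGrpCat.{u}
  have : PreservesColimitsOfShape (Discrete I) E := inferInstance
  have h := closure_range_inj_eq_top (isColimitCofanMap E hc)
  obtain ⟨s, y, hy⟩ := exists_finset_sum_of_mem_closure
    (fun i => (E.map (c.inj i)).hom) (x := yonEval f) (h.ge (AddSubgroup.mem_top _))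
  choose g hg using fun i => yonEval_surjective (K := K) (a := a) (M := X i) (y i)
  refine ⟨s, g, yonEval_injective (hy.trans ?_)⟩
  rw [yonEval_sum]
  refine Finset.sum_congr rfl fun i _ => ?_
  rw [yonEval_comp, hg]
  rfl

end RightModules

/-! ### From compact generation to well generation -/

section Generation

variable {T : Type v} [Category.{w} T] [Preadditive T] [HasCoproducts.{u} T] {S : ObjectProperty T}

lemma satisfiesG2_of_factorsFinitely (hS : ∀ C, S C → FactorsFinitely.{u} C) :
    SatisfiesG2.{u} S := by
  intro I X Y φ h C hC f
  obtain ⟨s, g, rfl⟩ := hS C hC I Y _ (coproductIsCoproduct Y) f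
  choose k hk using fun i => h i C hC (g i)
  refine ⟨∑ i ∈ s, k i ≫ Sigma.ι X i, ?_⟩
  dsimp only
  rw [Preadditive.sum_comp]
  refine Finset.sum_congr rfl fun i _ => ?_
  rw [Category.assoc, Sigma.ι_map, ← Category.assoc]
  exact hk i =≫ _

lemma FactorsFinitely.isCardinalSmall {C : T} (hC : FactorsFinitely.{u} C) :
    IsCardinalSmall.{u} Cardinal.aleph0 C := by
  intro I X f
  obtain ⟨s, g, rfl⟩ := hC I X _ (coproductIsCoproduct X) f
  refine ⟨s, Cardinal.mk_lt_aleph0_iff.2 (Finset.finite_toSet s),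
    ∑ i : (s : Set I), g i ≫ Sigma.ι (fun j : (s : Set I) => X j) i, ?_⟩
  rw [Preadditive.sum_comp, ← Finset.sum_coe_sort s]
  refine Finset.sum_congr rfl fun i _ => ?_
  rw [Category.assoc, Sigma.ι_desc]
  rfl

lemma satisfiesG3_of_factorsFinitely (hS : ∀ C, S C → FactorsFinitely.{u} C) :
    SatisfiesG3.{u} S :=
  ⟨_, Cardinal.isRegular_aleph0, fun C hC => (hS C hC).isCardinalSmall⟩

end Generation

lemma IsCompactlyGeneratedBy.isWellGenerated {T : Type v} [Category.{w} T] [Preadditive T]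
    [HasShift T ℤ] {S : ObjectProperty T} (hS : IsCompactlyGeneratedBy.{u} S) :
    IsWellGenerated.{u} T where
  locallySmall := hS.locallySmall
  hasCoproducts := hS.hasCoproducts
  exists_generators :=
    have := hS.hasCoproducts
    have h (C : T) (hC : S C) := (hS.isCompactObject C hC).factorsFinitely
    ⟨S, hS.essentiallySmall, hS.satisfiesG1, satisfiesG2_of_factorsFinitely h,
      satisfiesG3_of_factorsFinitely h⟩

/-! ### The derived category of modules and its quotient -/

section DerivedCategoryOfModules

variable (K : Type u) [CommRing K] (A : Type v) [Category.{u} A] [Preadditive A] [Linear K A]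

instance : HasCoproducts.{u} (RightMod K A) := fun _ => inferInstance

variable [HasDerivedCategory.{w} (RightMod K A)]

instance hasCoproducts_D : HasCoproducts.{u} (D K A) :=
  hasCoproducts_derivedCategory (fun a : A => (yon K A).obj a) rightMod_hom_ext factorsFinitely_yon

variable {K A}

lemma isCompactObject_yonD (a : A) : IsCompactObject.{u} ((yonD K A).obj a) :=
  (factorsFinitely_singleFunctor (fun a : A => (yon K A).obj a) rightMod_hom_ext
    factorsFinitely_yon a 0).isCompactObject

variable (L : ObjectProperty (D K A)) [L.IsTriangulated]

lemma preservesCoproducts_quotFunctor {I : Type u} [L.IsClosedUnderColimitsOfShape (Discrete I)] :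
    PreservesColimitsOfShape (Discrete I) (quotFunctor L) :=
  preservesCoproducts_of_isLocalization _ L.trW (trW_sigmaMap L)

variable {L}

/-- The images of the representable modules in `D(A)/L` detect zero objects. -/
lemma satisfiesG1_quotYon [EssentiallySmall.{u} A]
    (hL : ∀ I : Type u, L.IsClosedUnderColimitsOfShape (Discrete I)) :
    SatisfiesG1 (ObjectProperty.ofObj (fun a : A => quotYon L a)) := by
  intro X
  refine ⟨fun hX C _ j f => ((shiftFunctor _ j).map_isZero hX).eq_of_tgt _ _, fun hX => ?_⟩
  have (I : Type u) : PreservesColimitsOfShape (Discrete I) (quotFunctor L) :=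
    preservesCoproducts_quotFunctor L
  have := Localization.essSurj (quotFunctor L) L.trW
  -- The devissage takes coproducts over the generators, so they are indexed by a small model of
  -- `A`, and by all degrees to be stable under shifts.
  let e : SmallModel.{u} A → A := fun s => (equivSmallModel A).inverse.obj s
  let G : SmallModel.{u} A → RightMod K A := fun s => (yon K A).obj (e s)
  have hG {M N : RightMod K A} (f g : M ⟶ N) (h : ∀ s (x : G s ⟶ M), x ≫ f = x ≫ g) :
      f = g := rightMod_hom_ext f g fun a x => by
    let i : a ≅ e ((equivSmallModel A).functor.obj a) := (equivSmallModel A).unitIso.app a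
    rw [← cancel_epi ((yon K A).map i.inv), ← Category.assoc, ← Category.assoc]
    exact h _ _
  let S : SmallModel.{u} A × ℤ → D K A := fun p =>
    (DerivedCategory.singleFunctor (RightMod K A) p.2).obj (G p.1)
  have hshift (p : SmallModel.{u} A × ℤ) : ∃ q, Nonempty ((S q)⟦(1 : ℤ)⟧ ≅ S p) :=
    ⟨(p.1, p.2 + 1), ⟨((DerivedCategory.singleFunctors (RightMod K A)).shiftIso 1 p.2 (p.2 + 1)
      (add_comm _ _)).app (G p.1)⟩⟩
  have hS (p : SmallModel.{u} A × ℤ) (f : (quotFunctor L).obj (S p) ⟶ X) : f = 0 := by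
    let i : (S p)⟦p.2⟧ ≅ (yonD K A).obj (e p.1) :=
      ((DerivedCategory.singleFunctors (RightMod K A)).shiftIso p.2 0 p.2 (add_zero _)).app (G p.1)
    -- A module in degree `p.2` shifted by `p.2` sits in degree `0`, so `f⟦p.2⟧'` becomes a map from
    -- `quotYon` to `X⟦p.2⟧`, which the hypothesis kills.
    have h := hX _ (ObjectProperty.ofObj_apply _ (e p.1)) p.2
      ((quotFunctor L).map i.inv ≫ ((quotFunctor L).commShiftIso p.2).hom.app (S p) ≫ f⟦p.2⟧')
    apply (shiftFunctor _ p.2).map_injective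
    rw [← cancel_epi (((quotFunctor L).commShiftIso p.2).hom.app (S p)),
      ← cancel_epi ((quotFunctor L).map i.inv), h, Functor.map_zero, comp_zero, comp_zero]
  have h₀ := eq_zero_of_generates (quotFunctor L) (S := S) hshift
    (fun M hM => isZero_of_forall_singleFunctor G hG M fun s n => hM (s, n))
    (fun p => factorsFinitely_singleFunctor G hG (fun _ => factorsFinitely_yon _) p.1 p.2) hS
    ((quotFunctor L).objObjPreimageIso X).hom
  rw [IsZero.iff_id_eq_zero, ← Iso.inv_hom_id ((quotFunctor L).objObjPreimageIso X), h₀, comp_zero]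

lemma isCompactlyGeneratedBy_quotYon [EssentiallySmall.{u} A]
    (hL : ∀ I : Type u, L.IsClosedUnderColimitsOfShape (Discrete I))
    (hsmall : LocallySmall.{u} (VerdierQuot L)) (ha2 : ConditionA2 L) :
    IsCompactlyGeneratedBy.{u} (ObjectProperty.ofObj (fun a : A => quotYon L a)) where
  locallySmall := hsmall
  hasCoproducts I := by
    have : PreservesColimitsOfShape (Discrete I) (quotFunctor L) :=
      preservesCoproducts_quotFunctor L
    have := Localization.essSurj (quotFunctor L) L.trW
    exact hasCoproducts_of_preservesCoproducts (quotFunctor L)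
  essentiallySmall :=
    .of_le (Q := (yonD K A ⋙ quotFunctor L).essImage) (by
      rintro _ ⟨a⟩
      exact (yonD K A ⋙ quotFunctor L).obj_mem_essImage a)
  isCompactObject := by
    rintro _ ⟨a⟩
    exact ha2 _ (isCompactObject_yonD a)
  satisfiesG1 := satisfiesG1_quotYon hL

lemma ConditionB2.conditionB1 (ha2 : ConditionA2 L) (hb2 : ConditionB2 L) : ConditionB1 L := by
  intro a I b k hk c hc f
  obtain ⟨s, g, rfl⟩ := (ha2 _ (isCompactObject_yonD a)).factorsFinitely I _ c hc f
  exact Finset.sum_eq_zero fun i _ => by rw [hb2 a (b i) (k i) (hk i) (g i), zero_comp]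

end DerivedCategoryOfModules

end VerdierCompact

theorem mainTheorem8 {K : Type u} [CommRing K]
    {A : Type v} [Category.{u} A] [Preadditive A] [Linear K A] [EssentiallySmall.{u} A]
    [HasDerivedCategory.{w} (VerdierCompact.RightMod K A)]
    (L : ObjectProperty (VerdierCompact.D K A)) [L.IsTriangulated]
    (hL : ∀ I : Type u, L.IsClosedUnderColimitsOfShape (Discrete I))
    (hsmall : LocallySmall.{u} (VerdierCompact.VerdierQuot L))
    (ha2 : VerdierCompact.ConditionA2 L) :
    VerdierCompact.IsCompactlyGeneratedBy.{u}
        (ObjectProperty.ofObj (fun a : A => VerdierCompact.quotYon L a)) ∧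
      VerdierCompact.IsWellGenerated.{u} (VerdierCompact.VerdierQuot L) ∧
      (VerdierCompact.ConditionB2 L → VerdierCompact.ConditionB1 L) :=
  have h := VerdierCompact.isCompactlyGeneratedBy_quotYon hL hsmall ha2
  ⟨h, h.isWellGenerated, fun hb2 => hb2.conditionB1 ha2⟩
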